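/- Let $l\ge 2$ and $k\ge 1$ be integers and let $c\in(0,1)$. For each integer $m\ge 1$ put $q_m=c^{1/m}$ and consider the $q_m$-Pólya urn with colors $1,\dots,l$: it starts, not empty, with $A^{(m)}_{0,i}\in\mathbb N=\{0,1,2,\dots\}$ balls of color $i$ for $i=1,\dots,l$, and at each step, if it contains $w_j$ balls of color $j$ for each $j$, then, conditionally on the past, $k$ balls of color $i$ are added with probability $$q_m^{\,w_1+\cdots+w_{i-1}}\,\frac{[w_i]_{q_m}}{[w_1+\cdots+w_l]_{q_m}},\qquad [x]_q:=\frac{q^x-1}{q-1},\qquad i=1,\dots,l.$$ Let $A^{(m)}_{n,i}$ be the number of balls of color $i$ after $n$ steps. Assume that $$\frac1m\big(A^{(m)}_{0,1},\dots,A^{(m)}_{0,l}\big)\to(a_1,\dots,a_l)\quad\text{as } m\to\infty,$$ where $a_1,\dots,a_l\in[0,\infty)$ are not all zero. Set $\sigma_0=0$ and $\sigma_i=\sum_{j\le i}a_j$ for $i=1,\dots,l$. Then, as $m\to\infty$, the process $$\Big(\tfrac1m A^{(m)}_{[mt],1},\dots,\tfrac1m A^{(m)}_{[mt],l}\Big)_{t\ge0}$$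 converges in distribution, in the space $D_{\mathbb R^l}[0,\infty)$ of right continuous paths with left limits endowed with the Skorokhod topology, to the deterministic path $(X_{t,1},\dots,X_{t,l})_{t\ge0}$ with $$X_{t,i}=a_i+\frac{1}{\log c}\,\log\frac{(1-c^{\sigma_l+kt})-c^{\sigma_{i-1}}(1-c^{kt})}{(1-c^{\sigma_l+kt})-c^{\sigma_i}(1-c^{kt})}\qquad\text{for all } t\ge0,\ i=1,\dots,l.$$ -/

import Mathlib

open Filter Topology MeasureTheory
open scoped NNReal

/-- A path `f : [0, ∞) → E` is càdlàg if it is right continuous and has a limit from the left at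
every point (for `t = 0` the condition on the left limit is void). -/
def IsCadlag {E : Type*} [TopologicalSpace E] (f : ℝ≥0 → E) : Prop :=
  ∀ t : ℝ≥0, ContinuousWithinAt f (Set.Ici t) t ∧ ∃ y : E, Tendsto f (𝓝[<] t) (𝓝 y)

/-- The space `D_E[0, ∞)` of càdlàg paths in `E`. -/
structure SkorokhodSpace (E : Type*) [TopologicalSpace E] where
  toFun : ℝ≥0 → E
  isCadlag : IsCadlag toFun

namespace SkorokhodSpace

instance {E : Type*} [TopologicalSpace E] : CoeFun (SkorokhodSpace E) (fun _ => ℝ≥0 → E) :=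
  ⟨SkorokhodSpace.toFun⟩

/-- The basic Skorokhod (`J₁`) neighbourhoods of a path `x`: all paths `y` for which there is a
time change `γ` (an increasing bijection of `[0, ∞)`) such that on `[0, T]` the time change is
`ε`-close to the identity and `y` is `ε`-close to `x ∘ γ`. -/
def basicNhd {E : Type*} [PseudoMetricSpace E] (x : SkorokhodSpace E) (T : ℝ≥0) (ε : ℝ) :
    Set (SkorokhodSpace E) :=
  {y | ∃ γ : ℝ≥0 ≃o ℝ≥0, ∀ t ≤ T, dist (γ t) t < ε ∧ dist (y t) (x (γ t)) < ε}

theorem basicNhd_mono {E : Type*} [PseudoMetricSpace E] (x : SkorokhodSpace E) {T T' : ℝ≥0}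
    {ε ε' : ℝ} (hT : T' ≤ T) (hε : ε ≤ ε') : x.basicNhd T ε ⊆ x.basicNhd T' ε' := by
  rintro y ⟨γ, h⟩
  exact ⟨γ, fun t ht => ⟨(h t (ht.trans hT)).1.trans_le hε, (h t (ht.trans hT)).2.trans_le hε⟩⟩

/-- The Skorokhod topology on `D_E[0, ∞)`. A sequence `x n` converges to `x` in it if and only if
for every `T` there are time changes `γ n` with `sup_{t ≤ T} |γ n t - t| → 0` and
`sup_{t ≤ T} dist (x n t) (x (γ n t)) → 0`, which is the usual description of convergence in the
(metrizable) Skorokhod topology. -/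
instance {E : Type*} [PseudoMetricSpace E] : TopologicalSpace (SkorokhodSpace E) where
  IsOpen U := ∀ x ∈ U, ∃ T : ℝ≥0, ∃ ε : ℝ, 0 < ε ∧ x.basicNhd T ε ⊆ U
  isOpen_univ := fun _ _ => ⟨0, 1, one_pos, Set.subset_univ _⟩
  isOpen_inter := by
    rintro U V hU hV x ⟨hxU, hxV⟩
    obtain ⟨T, ε, hε, h⟩ := hU x hxU
    obtain ⟨T', ε', hε', h'⟩ := hV x hxV
    exact ⟨max T T', min ε ε', lt_min hε hε', Set.subset_inter
      ((x.basicNhd_mono (le_max_left _ _) (min_le_left _ _)).trans h)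
      ((x.basicNhd_mono (le_max_right _ _) (min_le_right _ _)).trans h')⟩
  isOpen_sUnion := by
    rintro S hS x ⟨U, hU, hxU⟩
    obtain ⟨T, ε, hε, h⟩ := hS U hU x hxU
    exact ⟨T, ε, hε, h.trans (Set.subset_sUnion_of_mem hU)⟩

/-- `D_E[0, ∞)` carries the Borel σ-algebra of the Skorokhod topology. -/
instance {E : Type*} [PseudoMetricSpace E] : MeasurableSpace (SkorokhodSpace E) := borel _

instance {E : Type*} [PseudoMetricSpace E] : BorelSpace (SkorokhodSpace E) := ⟨rfl⟩

end SkorokhodSpace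

/-- Step paths `t ↦ g ⌊r t⌋` are càdlàg. -/
theorem isCadlag_comp_floor {E : Type*} [TopologicalSpace E] (g : ℕ → E) (r : ℝ) (hr : 0 < r) :
    IsCadlag (fun t : ℝ≥0 => g ⌊r * (t : ℝ)⌋₊) := by
  intro t
  have hcont : Continuous (fun s : ℝ≥0 => r * (s : ℝ)) := by fun_prop
  constructor
  · have h1 : ∀ᶠ s : ℝ≥0 in 𝓝[≥] t, g ⌊r * (t : ℝ)⌋₊ = g ⌊r * (s : ℝ)⌋₊ := by
      have h2 : ∀ᶠ s : ℝ≥0 in 𝓝[≥] t, r * (s : ℝ) < ⌊r * (t : ℝ)⌋₊ + 1 :=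
        (hcont.continuousAt.eventually_lt continuousAt_const
          (Nat.lt_floor_add_one _)).filter_mono nhdsWithin_le_nhds
      filter_upwards [h2, self_mem_nhdsWithin] with s hs hts
      have hle : r * (t : ℝ) ≤ r * (s : ℝ) :=
        mul_le_mul_of_nonneg_left (NNReal.coe_le_coe.mpr hts) hr.le
      have : ⌊r * (s : ℝ)⌋₊ = ⌊r * (t : ℝ)⌋₊ :=
        (Nat.floor_eq_iff (by positivity)).mpr
          ⟨(Nat.floor_le (by positivity)).trans hle, hs⟩
      rw [this]
    exact tendsto_const_nhds.congr' h1
  · refine ⟨g (⌈r * (t : ℝ)⌉₊ - 1), ?_⟩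
    have h1 : ∀ᶠ s : ℝ≥0 in 𝓝[<] t, g (⌈r * (t : ℝ)⌉₊ - 1) = g ⌊r * (s : ℝ)⌋₊ := by
      rcases eq_or_ne t 0 with rfl | ht
      · filter_upwards [self_mem_nhdsWithin] with s hs
        exact absurd hs (by simp)
      · have htpos : 0 < r * (t : ℝ) := mul_pos hr (NNReal.coe_pos.mpr (pos_iff_ne_zero.mpr ht))
        have hceil : 1 ≤ ⌈r * (t : ℝ)⌉₊ := Nat.one_le_ceil_iff.mpr htpos
        have hlt : ((⌈r * (t : ℝ)⌉₊ - 1 : ℕ) : ℝ) < r * (t : ℝ) :=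
          Nat.lt_ceil.mp (by omega)
        have h2 : ∀ᶠ s : ℝ≥0 in 𝓝[<] t, ((⌈r * (t : ℝ)⌉₊ - 1 : ℕ) : ℝ) < r * (s : ℝ) :=
          (continuousAt_const.eventually_lt hcont.continuousAt hlt).filter_mono
            nhdsWithin_le_nhds
        filter_upwards [h2, self_mem_nhdsWithin] with s hs hst
        have hst' : r * (s : ℝ) < r * (t : ℝ) :=
          mul_lt_mul_of_pos_left (NNReal.coe_lt_coe.mpr hst) hr
        have : ⌊r * (s : ℝ)⌋₊ = ⌈r * (t : ℝ)⌉₊ - 1 := by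
          refine (Nat.floor_eq_iff (by positivity)).mpr ⟨hs.le, ?_⟩
          have h3 := hst'.trans_le (Nat.le_ceil (r * (t : ℝ)))
          have h4 : ((⌈r * (t : ℝ)⌉₊ - 1 : ℕ) : ℝ) + 1 = (⌈r * (t : ℝ)⌉₊ : ℝ) := by
            exact_mod_cast Nat.sub_add_cancel hceil
          rwa [h4]
        rw [this]
    exact tendsto_const_nhds.congr' h1

/-- The `q`-number `[n]_q = (q ^ n - 1) / (q - 1)`. -/
noncomputable def qNumber (q : ℝ) (n : ℕ) : ℝ := (q ^ n - 1) / (q - 1)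

/-- The probability that colour `i` is drawn from a `q`-Pólya urn that contains `w j` balls of
colour `j` for each `j`: it is `q ^ (∑_{j < i} w j) [w i]_q / [∑_j w j]_q`. -/
noncomputable def qPolyaDrawProb {l : ℕ} (q : ℝ) (w : Fin l → ℕ) (i : Fin l) : ℝ :=
  q ^ (∑ j ∈ Finset.Iio i, w j) * (qNumber q (w i) / qNumber q (∑ j, w j))

/-- The process `A` on the probability space `(Ω, μ)` is the composition process of a `q`-Pólya
urn with `l` colours and initial composition `w₀`: `A n ω i` is the number of balls of colour `i`
after `n` drawings, the urn is not empty at the start, and at each step, conditionally on the whole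
past, `k` balls of colour `i` are added with probability `qPolyaDrawProb q (A n) i`. -/
structure IsQPolyaUrn {l : ℕ} {Ω : Type*} [MeasurableSpace Ω] (μ : Measure Ω) (q : ℝ) (k : ℕ)
    (w₀ : Fin l → ℕ) (A : ℕ → Ω → Fin l → ℕ) : Prop where
  nonempty : ∃ i, w₀ i ≠ 0
  measurable : ∀ n, Measurable (A n)
  init : ∀ᵐ ω ∂μ, A 0 ω = w₀
  step : ∀ (n : ℕ) (x : ℕ → Fin l → ℕ) (i : Fin l),
    μ {ω | (∀ j ≤ n, A j ω = x j) ∧ A (n + 1) ω = x n + Pi.single i k} =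
      ENNReal.ofReal (qPolyaDrawProb q (x n) i) * μ {ω | ∀ j ≤ n, A j ω = x j}

/-- The rescaled path `t ↦ (w ⌊m t⌋ i / m)_i` of a sequence of compositions `w`, as an element of
`D_{ℝ^l}[0, ∞)`. (The topology of `Fin l → ℝ` is the Euclidean one, and the Skorokhod topology is
the same for all norms on `ℝ^l`.) -/
noncomputable def rescaledPath {l : ℕ} (m : ℕ+) (w : ℕ → Fin l → ℕ) :
    SkorokhodSpace (Fin l → ℝ) where
  toFun := fun t i => (w ⌊(m : ℝ) * (t : ℝ)⌋₊ i : ℝ) / (m : ℝ)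
  isCadlag := isCadlag_comp_floor (fun n i => (w n i : ℝ) / (m : ℝ)) (m : ℝ)
    (by exact_mod_cast m.pos)

/-! For an initial segment `s` of colours, let `S n` be the number of balls with colours in `s` and
`N n` the total. Each drawing adds `k` balls, so `N n` is deterministic. The ratio `(q⁻¹ ^ S n - 1)
/ (q⁻¹ ^ N n - 1)` is a martingale (`sum_qPolyaDrawProb_mul_urnRatio`). For `q = c ^ (1 / m)` its
increments are `O(1 / m)` (`abs_urnRatio_sub_le`), so after `⌊m t⌋` drawings its variance is `O(1 /
m)`, and by Chebyshev it stays near its initial value. Solving for `S n` gives the limit of `S ⌊m t⌋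
/ m` at each fixed `t` (`tendsto_measure_sum_at`).

Since `S` is nondecreasing and the limit is continuous, convergence on a finite grid is already
uniform on `[0, T]`, so no maximal inequality is needed. A single colour is the difference of two
initial segments. Uniform closeness puts the path in a Skorokhod neighbourhood with trivial time
change, and convergence in probability to a constant gives convergence in distribution. -/

/-! ### Weak convergence to a deterministic path, and measurability of rescaled paths -/

namespace SkorokhodSpace

/-- Weak convergence to a Dirac mass follows from convergence in probability in the sense of the
basic Skorokhod neighbourhoods. -/
theorem tendstoInDistribution_dirac_of_basicNhd {E ι : Type*} [PseudoMetricSpace E]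
    {L : Filter ι} [L.IsCountablyGenerated] {Ω : ι → Type*} [∀ i, MeasurableSpace (Ω i)]
    (μ : ∀ i, Measure (Ω i)) [∀ i, IsProbabilityMeasure (μ i)]
    (Y : ∀ i, Ω i → SkorokhodSpace E) (hY : ∀ i, Measurable (Y i)) (X : SkorokhodSpace E)
    (h : ∀ (T : ℝ≥0) (ε : ℝ), 0 < ε →
      Tendsto (fun i => μ i (Y i ⁻¹' X.basicNhd T ε)ᶜ) L (𝓝 0)) :
    TendstoInDistribution Y L (fun _ : Unit => X) μ (Measure.dirac ()) where
  forall_aemeasurable i := (hY i).aemeasurable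
  aemeasurable_limit := measurable_const.aemeasurable
  tendsto := by
    -- Portmanteau: only open sets containing `X` matter, and each contains a basic neighbourhood.
    refine tendsto_of_forall_isOpen_le_liminf' fun G hG => ?_
    simp only [ProbabilityMeasure.coe_mk]
    rw [Measure.map_const, measure_univ, one_smul, Measure.dirac_apply' _ hG.measurableSet]
    by_cases hX : X ∈ G
    · obtain ⟨T, ε, hε, hsub⟩ := hG X hX
      rcases L.eq_or_neBot with rfl | hL
      · simp
      have h1 : Tendsto (fun i => 1 - μ i (Y i ⁻¹' X.basicNhd T ε)ᶜ) L (𝓝 1) := by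
        simpa using ENNReal.Tendsto.sub tendsto_const_nhds (h T ε hε) (Or.inl ENNReal.one_ne_top)
      rw [Set.indicator_of_mem hX, Pi.one_apply, ← h1.liminf_eq]
      refine liminf_le_liminf (Eventually.of_forall fun i => ?_)
      -- Complements are taken for the open set `G`, since the basic neighbourhood is not known to
      -- be measurable.
      rw [Measure.map_apply (hY i) hG.measurableSet, tsub_le_iff_right,
        ← prob_add_prob_compl (μ := μ i) (hY i hG.measurableSet)]
      gcongr
    · simp [hX]

end SkorokhodSpace

/-- On `[0, T]` the path depends on finitely many discrete coordinates of `w`, so nearby sequences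
give the same path there. This yields Borel measurability directly from the topology. -/
theorem continuous_rescaledPath {l : ℕ} (m : ℕ+) :
    Continuous (rescaledPath (l := l) m) := by
  refine ⟨fun U hU => ?_⟩
  rw [isOpen_iff_mem_nhds]
  intro w hw
  obtain ⟨T, ε, hε, hsub⟩ := hU _ hw
  have hev : ∀ᶠ v in 𝓝 w, ∀ n ∈ Finset.range (⌊(m : ℝ) * (T : ℝ)⌋₊ + 1), v n = w n := by
    rw [Finset.eventually_all]
    intro n _
    have : Tendsto (fun v : ℕ → Fin l → ℕ => v n) (𝓝 w) (𝓝 (w n)) :=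
      (continuous_apply n).tendsto w
    rw [nhds_discrete (Fin l → ℕ)] at this
    exact tendsto_pure.mp this
  filter_upwards [hev] with v hv
  refine hsub ⟨OrderIso.refl _, fun t ht => ⟨by simpa using hε, ?_⟩⟩
  have : v ⌊(m : ℝ) * (t : ℝ)⌋₊ = w ⌊(m : ℝ) * (t : ℝ)⌋₊ := by
    refine hv _ (Finset.mem_range.mpr (Nat.lt_succ_of_le (Nat.floor_le_floor ?_)))
    gcongr
  simpa [rescaledPath, this] using hε

theorem measurable_rescaledPath_comp {l : ℕ} (m : ℕ+) {Ω : Type*} [MeasurableSpace Ω]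
    {A : ℕ → Ω → Fin l → ℕ} (hA : ∀ n, Measurable (A n)) :
    Measurable fun ω => rescaledPath m fun n => A n ω :=
  (continuous_rescaledPath m).measurable.comp (measurable_pi_lambda _ hA)

/-! ### Draw probabilities and the one-step law of the urn -/

namespace MeasureTheory

theorem measure_eq_tsum_inter_preimage_singleton {α β : Type*} [MeasurableSpace α]
    [MeasurableSpace β] [Countable β] [MeasurableSingletonClass β] (μ : Measure α) {H : α → β}
    (hH : Measurable H) (s : Set α) : μ s = ∑' b, μ (H ⁻¹' {b} ∩ s) := by
  have h := lintegral_countable' (μ := (μ.restrict s).map H) (fun _ => 1)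
  simp only [lintegral_const, one_mul] at h
  rw [Measure.map_apply hH .univ] at h
  simp only [Set.preimage_univ, Measure.restrict_apply_univ] at h
  rw [h]
  refine tsum_congr fun b => ?_
  rw [Measure.map_apply hH (measurableSet_singleton b),
    Measure.restrict_apply (hH (measurableSet_singleton b))]

end MeasureTheory

theorem single_injective {l k : ℕ} (hk : 0 < k) :
    Function.Injective fun i : Fin l => (Pi.single i k : Fin l → ℕ) := by
  intro i j h
  by_contra hij
  have := congrFun h i
  simp [hij] at this
  omega

/-- Colours in a lower set `s` are drawn with total probability
`(1 - q ^ ∑_{j ∈ s} w j) / (1 - q ^ ∑_j w j)`. -/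
theorem sum_qPolyaDrawProb {l : ℕ} {q : ℝ} (hq1 : q < 1) (w : Fin l → ℕ)
    {s : Finset (Fin l)} (hs : IsLowerSet (s : Set (Fin l))) :
    ∑ i ∈ s, qPolyaDrawProb q w i = (1 - q ^ ∑ j ∈ s, w j) / (1 - q ^ ∑ j, w j) := by
  -- The sum telescopes: this is the expansion of `1 - ∏ q ^ w i` over the ordered set `s`. That `s`
  -- is a lower set identifies the partial products with those over `Iio i`.
  have h := Finset.prod_one_sub_ordered s (fun i => 1 - q ^ w i)
  simp only [sub_sub_cancel] at h
  rw [Finset.prod_pow_eq_pow_sum] at h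
  rw [h, sub_sub_cancel, Finset.sum_div]
  refine Finset.sum_congr rfl fun i hi => ?_
  have hf : s.filter (· < i) = Finset.Iio i := by
    ext j
    simp only [Finset.mem_filter, Finset.mem_Iio, and_iff_right_iff_imp]
    exact fun hj => hs hj.le hi
  rw [hf, Finset.prod_pow_eq_pow_sum, qPolyaDrawProb, qNumber, qNumber,
    div_div_div_cancel_right₀ (by linarith), ← neg_div_neg_eq (q ^ w i - 1)]
  rw [neg_sub, neg_sub]
  ring

theorem qPolyaDrawProb_nonneg {l : ℕ} {q : ℝ} (hq0 : 0 < q) (hq1 : q < 1) (w : Fin l → ℕ)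
    (i : Fin l) : 0 ≤ qPolyaDrawProb q w i := by
  have h (n : ℕ) : 0 ≤ qNumber q n :=
    div_nonneg_of_nonpos (by linarith [pow_le_one₀ hq0.le hq1.le (n := n)]) (by linarith)
  exact mul_nonneg (by positivity) (div_nonneg (h _) (h _))

theorem sum_univ_qPolyaDrawProb {l : ℕ} {q : ℝ} (hq0 : 0 < q) (hq1 : q < 1) (w : Fin l → ℕ)
    (hw : ∑ j, w j ≠ 0) : ∑ i, qPolyaDrawProb q w i = 1 := by
  rw [sum_qPolyaDrawProb hq1 w (by simpa using isLowerSet_univ), div_self]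
  linarith [pow_lt_one₀ hq0.le hq1 hw]

namespace IsQPolyaUrn

variable {l : ℕ} {Ω : Type*} [MeasurableSpace Ω] {μ : Measure Ω} {q : ℝ} {k : ℕ}
  {w₀ : Fin l → ℕ} {A : ℕ → Ω → Fin l → ℕ}

/-- The Markov property. -/
theorem measure_step (hA : IsQPolyaUrn μ q k w₀ A) (n : ℕ) (x : Fin l → ℕ) (i : Fin l) :
    μ {ω | A n ω = x ∧ A (n + 1) ω = x + Pi.single i k} =
      ENNReal.ofReal (qPolyaDrawProb q x i) * μ {ω | A n ω = x} := by
  have hH : Measurable fun ω (j : Fin (n + 1)) => A j ω :=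
    measurable_pi_lambda _ fun j => hA.measurable j
  rw [measure_eq_tsum_inter_preimage_singleton μ hH {ω | A n ω = x},
    measure_eq_tsum_inter_preimage_singleton μ hH, ← ENNReal.tsum_mul_left]
  refine tsum_congr fun h => ?_
  -- The step axiom takes an infinite history but reads it only up to time `n`; the value `0`
  -- afterwards is irrelevant.
  let y : ℕ → Fin l → ℕ := fun j => if hj : j < n + 1 then h ⟨j, hj⟩ else 0
  have hmem (ω : Ω) : (fun j : Fin (n + 1) => A j ω) = h ↔ ∀ j ≤ n, A j ω = y j := by
    rw [funext_iff]
    constructor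
    · intro H j hj
      have hj' : j < n + 1 := by omega
      simpa only [y, hj', dif_pos] using H ⟨j, hj'⟩
    · intro H j
      have := H j (by omega)
      simpa only [y, j.isLt, dif_pos] using this
  by_cases hx : y n = x
  · convert hA.step n y i using 3
    · ext ω
      simp only [Set.mem_inter_iff, Set.mem_preimage, Set.mem_singleton_iff, hmem,
        Set.mem_ofPred_eq, ← hx]
      exact ⟨fun H => ⟨H.1, H.2.2⟩, fun H => ⟨H.1, H.1 n le_rfl, H.2⟩⟩
    · rw [hx]
    · ext ω
      simp only [Set.mem_inter_iff, Set.mem_preimage, Set.mem_singleton_iff, hmem,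
        Set.mem_ofPred_eq, ← hx]
      exact ⟨fun H => H.1, fun H => ⟨H, H n le_rfl⟩⟩
  · have h0 (s : Set Ω) (hs : s ⊆ {ω | A n ω = x}) :
        (fun ω (j : Fin (n + 1)) => A j ω) ⁻¹' {h} ∩ s = ∅ := by
      ext ω
      simp only [Set.mem_inter_iff, Set.mem_preimage, Set.mem_singleton_iff, hmem,
        Set.mem_empty_iff_false, iff_false, not_and]
      intro H H'
      exact hx ((H n le_rfl).symm.trans (hs H'))
    rw [h0 _ fun ω h => h.1, h0 _ fun ω h => h]
    simp

theorem sum_init_ne_zero (hA : IsQPolyaUrn μ q k w₀ A) : ∑ j, w₀ j ≠ 0 := by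
  obtain ⟨i, hi⟩ := hA.nonempty
  exact fun h => hi (Finset.sum_eq_zero_iff.mp h i (Finset.mem_univ i))

theorem measurableSet_eq (hA : IsQPolyaUrn μ q k w₀ A) (n : ℕ) (x : Fin l → ℕ) :
    MeasurableSet {ω | A n ω = x} :=
  hA.measurable n (measurableSet_singleton x)

/-- The urn axioms only give the mass of each transition. For a nonempty urn the draw probabilities
sum to `1`, and the transitions are disjoint as `k > 0`, so together they exhaust `{A n = x}` up to
a null set. -/
theorem ae_step_of_sum_ne_zero [IsProbabilityMeasure μ] (hA : IsQPolyaUrn μ q k w₀ A)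
    (hk : 0 < k) (hq0 : 0 < q) (hq1 : q < 1) (n : ℕ) (h : ∀ᵐ ω ∂μ, ∑ j, A n ω j ≠ 0) :
    ∀ᵐ ω ∂μ, ∃ i, A (n + 1) ω = A n ω + Pi.single i k := by
  have key (x : Fin l → ℕ) (hx : ∑ j, x j ≠ 0) :
      ∀ᵐ ω ∂μ, A n ω = x → ∃ i, A (n + 1) ω = x + Pi.single i k := by
    let E : Fin l → Set Ω := fun i => {ω | A n ω = x ∧ A (n + 1) ω = x + Pi.single i k}
    have hE (i : Fin l) : MeasurableSet (E i) :=
      (hA.measurableSet_eq n x).inter (hA.measurableSet_eq (n + 1) _)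
    have hdisj : Pairwise (Function.onFun Disjoint E) := by
      intro i j hij
      refine Set.disjoint_left.mpr fun ω h1 h2 => hij (single_injective hk ?_)
      exact add_left_cancel (h1.2.symm.trans h2.2)
    have hmeas : μ (⋃ i, E i) = μ {ω | A n ω = x} := by
      rw [measure_iUnion hdisj hE, tsum_fintype]
      simp only [E, hA.measure_step]
      rw [← Finset.sum_mul, ← ENNReal.ofReal_sum_of_nonneg
        fun i _ => qPolyaDrawProb_nonneg hq0 hq1 x i, sum_univ_qPolyaDrawProb hq0 hq1 x hx]
      simp
    have hsub : (⋃ i, E i) ⊆ {ω | A n ω = x} := Set.iUnion_subset fun i ω h => h.1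
    have hnull := ae_eq_of_subset_of_measure_ge hsub hmeas.ge
      (MeasurableSet.iUnion hE).nullMeasurableSet (measure_ne_top _ _)
    filter_upwards [hnull] with ω hω hωx
    have : ω ∈ ⋃ i, E i := (iff_of_eq hω).mpr hωx
    obtain ⟨i, hi⟩ := Set.mem_iUnion.mp this
    exact ⟨i, hi.2⟩
  have hall : ∀ᵐ ω ∂μ, ∀ x : Fin l → ℕ, ∑ j, x j ≠ 0 → A n ω = x →
      ∃ i, A (n + 1) ω = x + Pi.single i k := by
    rw [ae_all_iff]
    intro x
    by_cases hx : ∑ j, x j ≠ 0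
    · simpa [hx] using key x hx
    · exact Eventually.of_forall fun ω h => absurd h hx
  filter_upwards [hall, h] with ω h1 h2
  exact h1 _ h2 rfl

theorem ae_sum_eq [IsProbabilityMeasure μ] (hA : IsQPolyaUrn μ q k w₀ A)
    (hk : 0 < k) (hq0 : 0 < q) (hq1 : q < 1) (n : ℕ) :
    ∀ᵐ ω ∂μ, ∑ j, A n ω j = ∑ j, w₀ j + k * n := by
  induction n with
  | zero =>
    filter_upwards [hA.init] with ω h
    simp [h]
  | succ n ih =>
    have hne : ∀ᵐ ω ∂μ, ∑ j, A n ω j ≠ 0 := by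
      filter_upwards [ih] with ω h
      have := hA.sum_init_ne_zero
      omega
    filter_upwards [ih, hA.ae_step_of_sum_ne_zero hk hq0 hq1 n hne] with ω h1 ⟨i, h2⟩
    simp only [h2, Pi.add_apply, Finset.sum_add_distrib, h1, Finset.sum_pi_single',
      Finset.mem_univ, if_true]
    ring

theorem ae_step [IsProbabilityMeasure μ] (hA : IsQPolyaUrn μ q k w₀ A)
    (hk : 0 < k) (hq0 : 0 < q) (hq1 : q < 1) :
    ∀ᵐ ω ∂μ, ∀ n, ∃ i, A (n + 1) ω = A n ω + Pi.single i k := by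
  rw [ae_all_iff]
  refine fun n => hA.ae_step_of_sum_ne_zero hk hq0 hq1 n ?_
  filter_upwards [hA.ae_sum_eq hk hq0 hq1 n] with ω h
  have := hA.sum_init_ne_zero
  omega

-- An integrated form of conditioning on `A n`, which replaces conditional expectations in the
-- variance estimate.
open scoped ENNReal in
theorem lintegral_succ [IsProbabilityMeasure μ] (hA : IsQPolyaUrn μ q k w₀ A)
    (hk : 0 < k) (hq0 : 0 < q) (hq1 : q < 1) (n : ℕ) (g : (Fin l → ℕ) → ℝ≥0∞) :
    ∫⁻ ω, g (A (n + 1) ω) ∂μ =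
      ∫⁻ ω, ∑ i, ENNReal.ofReal (qPolyaDrawProb q (A n ω) i) *
        g (A n ω + Pi.single i k) ∂μ := by
  have hE (x : Fin l → ℕ) (i : Fin l) :
      MeasurableSet {ω | A n ω = x ∧ A (n + 1) ω = x + Pi.single i k} :=
    (hA.measurableSet_eq n x).inter (hA.measurableSet_eq (n + 1) _)
  have h1 : ∀ᵐ ω ∂μ, g (A (n + 1) ω) = ∑' x : Fin l → ℕ, ∑ i,
      Set.indicator {ω | A n ω = x ∧ A (n + 1) ω = x + Pi.single i k}
        (fun _ => g (x + Pi.single i k)) ω := by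
    filter_upwards [hA.ae_step hk hq0 hq1] with ω hω
    obtain ⟨i, hi⟩ := hω n
    rw [tsum_eq_single (A n ω), Finset.sum_eq_single i]
    · simp [hi]
    · intro j _ hj
      refine Set.indicator_of_notMem (fun h => hj (single_injective hk ?_)) _
      exact add_left_cancel (h.2.symm.trans hi)
    · simp
    · intro x hx
      exact Finset.sum_eq_zero fun i _ => Set.indicator_of_notMem (fun h => hx h.1.symm) _
  have h2 : ∫⁻ ω, ∑ i, ENNReal.ofReal (qPolyaDrawProb q (A n ω) i) *
        g (A n ω + Pi.single i k) ∂μ = ∑' x : Fin l → ℕ,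
        (∑ i, ENNReal.ofReal (qPolyaDrawProb q x i) * g (x + Pi.single i k)) *
          μ {ω | A n ω = x} := by
    refine (lintegral_map (f := fun x => ∑ i, ENNReal.ofReal (qPolyaDrawProb q x i) *
        g (x + Pi.single i k)) (measurable_of_countable _) (hA.measurable n)).symm.trans ?_
    rw [lintegral_countable']
    refine tsum_congr fun x => ?_
    rw [Measure.map_apply (hA.measurable n) (measurableSet_singleton x)]
    rfl
  rw [lintegral_congr_ae h1, h2, lintegral_tsum fun x => (Finset.measurable_fun_sum _ fun i _ =>
    measurable_const.indicator (hE x i)).aemeasurable]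
  refine tsum_congr fun x => ?_
  rw [lintegral_finsetSum _ fun i _ => measurable_const.indicator (hE x i), Finset.sum_mul]
  refine Finset.sum_congr rfl fun i _ => ?_
  rw [lintegral_indicator_const (hE x i), hA.measure_step]
  ring

end IsQPolyaUrn

/-! ### The martingale and its variance -/

/-- For a set `s` of colours, the ratio `(q ^ (-∑_{j ∈ s} w j) - 1) / (q ^ (-∑_j w j) - 1)`. If `s`
is a lower set, it is a martingale along a `q`-Pólya urn. -/
noncomputable def urnRatio {l : ℕ} (q : ℝ) (s : Finset (Fin l)) (w : Fin l → ℕ) : ℝ :=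
  (q⁻¹ ^ (∑ j ∈ s, w j) - 1) / (q⁻¹ ^ (∑ j, w j) - 1)

/-- A bound for the increments of `urnRatio` along an urn with at least `n` balls. -/
noncomputable def urnRatioStep (q : ℝ) (k n : ℕ) : ℝ :=
  (q⁻¹ ^ k - 1) * (q⁻¹ ^ n / (q⁻¹ ^ n - 1))

theorem sum_add_single {l : ℕ} (s : Finset (Fin l)) (w : Fin l → ℕ) (i : Fin l) (k : ℕ) :
    ∑ j ∈ s, (w + Pi.single i k : Fin l → ℕ) j = ∑ j ∈ s, w j + if i ∈ s then k else 0 := by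
  simp only [Pi.add_apply, Finset.sum_add_distrib, Finset.sum_pi_single']

theorem urnRatio_add_single {l : ℕ} (q : ℝ) (s : Finset (Fin l)) (w : Fin l → ℕ) (i : Fin l)
    (k : ℕ) : urnRatio q s (w + Pi.single i k) =
      (q⁻¹ ^ (∑ j ∈ s, w j) - 1) / (q⁻¹ ^ (∑ j, w j) * q⁻¹ ^ k - 1) +
      if i ∈ s then q⁻¹ ^ (∑ j ∈ s, w j) * (q⁻¹ ^ k - 1) / (q⁻¹ ^ (∑ j, w j) * q⁻¹ ^ k - 1)
      else 0 := by
  rw [urnRatio, sum_add_single, sum_add_single]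
  by_cases hi : i ∈ s
  · simp only [hi, Finset.mem_univ, if_true, pow_add]
    rw [← add_div]
    ring
  · simp [hi, pow_add]

/-- With `a`, `b`, `e` the powers of `q⁻¹` for `s`, the total and `k`, a colour in `s` is drawn with
probability `(1 - a⁻¹) / (1 - b⁻¹)`. The mean is then `(a - 1) / (b * e - 1) * (1 + b * (e - 1) / (b
- 1))`, and the last factor is `(b * e - 1) / (b - 1)`. -/
theorem sum_qPolyaDrawProb_mul_urnRatio {l : ℕ} {q : ℝ} (hq0 : 0 < q) (hq1 : q < 1)
    {s : Finset (Fin l)} (hs : IsLowerSet (s : Set (Fin l))) (k : ℕ) (w : Fin l → ℕ)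
    (hw : ∑ j, w j ≠ 0) :
    ∑ i, qPolyaDrawProb q w i * urnRatio q s (w + Pi.single i k) = urnRatio q s w := by
  simp only [urnRatio_add_single, mul_add, Finset.sum_add_distrib, mul_ite, mul_zero]
  rw [← Finset.sum_mul, sum_univ_qPolyaDrawProb hq0 hq1 w hw, Finset.sum_ite_mem,
    Finset.univ_inter, ← Finset.sum_mul, sum_qPolyaDrawProb hq1 w hs, urnRatio]
  have hp : 1 < q⁻¹ := (one_lt_inv₀ hq0).mpr hq1
  have ha : 0 < q⁻¹ ^ ∑ j ∈ s, w j := by positivity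
  have hb : 1 < q⁻¹ ^ ∑ j, w j := one_lt_pow₀ hp hw
  have he : 1 ≤ q⁻¹ ^ k := one_le_pow₀ hp.le
  have hqa : q ^ ∑ j ∈ s, w j = (q⁻¹ ^ ∑ j ∈ s, w j)⁻¹ := by rw [inv_pow, inv_inv]
  have hqb : q ^ ∑ j, w j = (q⁻¹ ^ ∑ j, w j)⁻¹ := by rw [inv_pow, inv_inv]
  rw [hqa, hqb]
  generalize q⁻¹ ^ ∑ j ∈ s, w j = a at *
  generalize q⁻¹ ^ ∑ j, w j = b at *
  generalize q⁻¹ ^ k = e at *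
  have h1 : b * e - 1 ≠ 0 := by nlinarith
  have h2 : b - 1 ≠ 0 := by linarith
  have h3 : b ≠ 0 := by linarith
  have h4 : 1 - b⁻¹ = (b - 1) / b := by field_simp
  rw [h4]
  field_simp
  ring

theorem abs_urnRatio_sub_le {l : ℕ} {q : ℝ} (hq0 : 0 < q) (hq1 : q < 1)
    (s : Finset (Fin l)) (k : ℕ) (w : Fin l → ℕ) {n : ℕ} (hn : n ≠ 0) (hw : n ≤ ∑ j, w j)
    (i : Fin l) :
    |urnRatio q s (w + Pi.single i k) - urnRatio q s w| ≤ urnRatioStep q k n := by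
  have hp : 1 < q⁻¹ := (one_lt_inv₀ hq0).mpr hq1
  have ha : 1 ≤ q⁻¹ ^ ∑ j ∈ s, w j := one_le_pow₀ hp.le
  have hab : q⁻¹ ^ ∑ j ∈ s, w j ≤ q⁻¹ ^ ∑ j, w j :=
    pow_le_pow_right₀ hp.le (Finset.sum_le_sum_of_subset (Finset.subset_univ s))
  have hnb : q⁻¹ ^ n ≤ q⁻¹ ^ ∑ j, w j := pow_le_pow_right₀ hp.le hw
  have hn1 : 1 < q⁻¹ ^ n := one_lt_pow₀ hp hn
  have he : 1 ≤ q⁻¹ ^ k := one_le_pow₀ hp.le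
  rw [urnRatio_add_single, urnRatio, urnRatioStep]
  generalize q⁻¹ ^ ∑ j ∈ s, w j = a at *
  generalize q⁻¹ ^ ∑ j, w j = b at *
  generalize q⁻¹ ^ k = e at *
  generalize q⁻¹ ^ n = d at *
  have hb1 : 0 < b - 1 := by linarith
  have hbe : 0 < b * e - 1 := by nlinarith
  have hd1 : 0 < d - 1 := by linarith
  -- `x / (x - 1)` decreases on `x > 1`, so the total may be replaced by its lower bound `n`.
  have hle : b / (b - 1) ≤ d / (d - 1) := by
    rw [div_le_div_iff₀ hb1 hd1]
    linarith
  refine le_trans ?_ (mul_le_mul_of_nonneg_left hle (by linarith))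
  rw [mul_div_assoc']
  split_ifs
  · have h : (a - 1) / (b * e - 1) + a * (e - 1) / (b * e - 1) - (a - 1) / (b - 1) =
        (e - 1) * ((b - a) / (b * e - 1)) / (b - 1) := by
      field_simp
      ring
    have h1 : (b - a) / (b * e - 1) ≤ b := by
      rw [div_le_iff₀ hbe]
      nlinarith
    have h0 : 0 ≤ (b - a) / (b * e - 1) := div_nonneg (by linarith) hbe.le
    have he' : 0 ≤ e - 1 := by linarith
    rw [h, abs_of_nonneg (by positivity)]
    gcongr
  · have h : (a - 1) / (b * e - 1) + 0 - (a - 1) / (b - 1) =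
        -((e - 1) * (b * ((a - 1) / (b * e - 1))) / (b - 1)) := by
      field_simp
      ring
    have h1 : (a - 1) / (b * e - 1) ≤ 1 := by
      rw [div_le_iff₀ hbe]
      nlinarith
    have h0 : 0 ≤ (a - 1) / (b * e - 1) := div_nonneg (by linarith) hbe.le
    have he' : 0 ≤ e - 1 := by linarith
    have hb0 : 0 ≤ b := by linarith
    rw [h, abs_neg, abs_of_nonneg (by positivity)]
    gcongr
    exact mul_le_of_le_one_right hb0 h1

theorem sum_qPolyaDrawProb_mul_sq_le {l : ℕ} {q : ℝ} (hq0 : 0 < q) (hq1 : q < 1)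
    {s : Finset (Fin l)} (hs : IsLowerSet (s : Set (Fin l))) (k : ℕ) (w : Fin l → ℕ)
    {n : ℕ} (hn : n ≠ 0) (hw : n ≤ ∑ j, w j) (r : ℝ) :
    ∑ i, qPolyaDrawProb q w i * (urnRatio q s (w + Pi.single i k) - r) ^ 2 ≤
      (urnRatio q s w - r) ^ 2 + urnRatioStep q k n ^ 2 := by
  have hw0 : ∑ j, w j ≠ 0 := by omega
  have hmean := sum_qPolyaDrawProb_mul_urnRatio hq0 hq1 hs k w hw0
  have hone := sum_univ_qPolyaDrawProb hq0 hq1 w hw0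
  set f := urnRatio q s w
  -- Expansion of the square around the current value `f`; by the martingale property the last two
  -- terms add up to `(f - r) ^ 2`.
  have hsplit : ∑ i, qPolyaDrawProb q w i * (urnRatio q s (w + Pi.single i k) - r) ^ 2 =
      ∑ i, qPolyaDrawProb q w i * (urnRatio q s (w + Pi.single i k) - f) ^ 2 +
      2 * (f - r) * ∑ i, qPolyaDrawProb q w i * urnRatio q s (w + Pi.single i k) +
      (r ^ 2 - f ^ 2) * ∑ i, qPolyaDrawProb q w i := by
    rw [Finset.mul_sum, Finset.mul_sum, ← Finset.sum_add_distrib, ← Finset.sum_add_distrib]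
    refine Finset.sum_congr rfl fun i _ => ?_
    ring
  have hbd : ∑ i, qPolyaDrawProb q w i * (urnRatio q s (w + Pi.single i k) - f) ^ 2 ≤
      ∑ i, qPolyaDrawProb q w i * urnRatioStep q k n ^ 2 := by
    refine Finset.sum_le_sum fun i _ =>
      mul_le_mul_of_nonneg_left ?_ (qPolyaDrawProb_nonneg hq0 hq1 w i)
    exact sq_le_sq' (abs_le.mp (abs_urnRatio_sub_le hq0 hq1 s k w hn hw i)).1
      (abs_le.mp (abs_urnRatio_sub_le hq0 hq1 s k w hn hw i)).2
  rw [← Finset.sum_mul, hone] at hbd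
  rw [hsplit, hmean, hone]
  linarith

namespace IsQPolyaUrn

variable {l : ℕ} {Ω : Type*} [MeasurableSpace Ω] {μ : Measure Ω} {q : ℝ} {k : ℕ}
  {w₀ : Fin l → ℕ} {A : ℕ → Ω → Fin l → ℕ}

/-- Orthogonality of martingale increments: each drawing adds at most one squared step, and the step
bound for the initial total serves at all times because the total never decreases. -/
theorem lintegral_sq_urnRatio_sub_le [IsProbabilityMeasure μ] (hA : IsQPolyaUrn μ q k w₀ A)
    (hk : 0 < k) (hq0 : 0 < q) (hq1 : q < 1) {s : Finset (Fin l)}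
    (hs : IsLowerSet (s : Set (Fin l))) (n : ℕ) :
    ∫⁻ ω, ENNReal.ofReal ((urnRatio q s (A n ω) - urnRatio q s w₀) ^ 2) ∂μ ≤
      ENNReal.ofReal (n * urnRatioStep q k (∑ j, w₀ j) ^ 2) := by
  induction n with
  | zero =>
    have h : ∀ᵐ ω ∂μ, ENNReal.ofReal ((urnRatio q s (A 0 ω) - urnRatio q s w₀) ^ 2) = 0 := by
      filter_upwards [hA.init] with ω hω
      simp [hω]
    rw [lintegral_congr_ae h]
    simp
  | succ n ih =>
    rw [hA.lintegral_succ hk hq0 hq1 n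
      (fun x => ENNReal.ofReal ((urnRatio q s x - urnRatio q s w₀) ^ 2))]
    have hle : ∀ᵐ ω ∂μ, ∑ i, ENNReal.ofReal (qPolyaDrawProb q (A n ω) i) *
        ENNReal.ofReal ((urnRatio q s (A n ω + Pi.single i k) - urnRatio q s w₀) ^ 2) ≤
        ENNReal.ofReal ((urnRatio q s (A n ω) - urnRatio q s w₀) ^ 2) +
          ENNReal.ofReal (urnRatioStep q k (∑ j, w₀ j) ^ 2) := by
      filter_upwards [hA.ae_sum_eq hk hq0 hq1 n] with ω hω
      simp only [← ENNReal.ofReal_mul (qPolyaDrawProb_nonneg hq0 hq1 _ _)]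
      rw [← ENNReal.ofReal_sum_of_nonneg fun i _ =>
        mul_nonneg (qPolyaDrawProb_nonneg hq0 hq1 _ i) (sq_nonneg _),
        ← ENNReal.ofReal_add (sq_nonneg _) (sq_nonneg _)]
      exact ENNReal.ofReal_le_ofReal (sum_qPolyaDrawProb_mul_sq_le hq0 hq1 hs k _
        hA.sum_init_ne_zero (by omega) _)
    refine (lintegral_mono_ae hle).trans ?_
    rw [lintegral_add_right _ measurable_const, lintegral_const, measure_univ, mul_one]
    refine (add_le_add_left ih _).trans ?_
    rw [← ENNReal.ofReal_add (by positivity) (sq_nonneg _)]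
    refine ENNReal.ofReal_le_ofReal (le_of_eq ?_)
    push_cast
    ring

theorem measure_le_abs_urnRatio_sub [IsProbabilityMeasure μ] (hA : IsQPolyaUrn μ q k w₀ A)
    (hk : 0 < k) (hq0 : 0 < q) (hq1 : q < 1) {s : Finset (Fin l)}
    (hs : IsLowerSet (s : Set (Fin l))) (n : ℕ) {δ : ℝ} (hδ : 0 < δ) :
    μ {ω | δ ≤ |urnRatio q s (A n ω) - urnRatio q s w₀|} ≤
      ENNReal.ofReal (n * urnRatioStep q k (∑ j, w₀ j) ^ 2 / δ ^ 2) := by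
  have hmeas : Measurable fun ω =>
      ENNReal.ofReal ((urnRatio q s (A n ω) - urnRatio q s w₀) ^ 2) :=
    (measurable_of_countable fun x =>
      ENNReal.ofReal ((urnRatio q s x - urnRatio q s w₀) ^ 2)).comp (hA.measurable n)
  have hδ2 : 0 < δ ^ 2 := by positivity
  have h := meas_ge_le_lintegral_div (μ := μ) hmeas.aemeasurable (ε := ENNReal.ofReal (δ ^ 2))
    (by simpa using hδ.ne') ENNReal.ofReal_ne_top
  rw [ENNReal.ofReal_div_of_pos hδ2]
  refine (measure_mono fun ω hω => ?_).trans
    (h.trans (ENNReal.div_le_div_right (hA.lintegral_sq_urnRatio_sub_le hk hq0 hq1 hs n) _))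
  refine ENNReal.ofReal_le_ofReal ?_
  rw [← sq_abs (urnRatio q s (A n ω) - urnRatio q s w₀)]
  exact pow_le_pow_left₀ hδ.le hω 2

end IsQPolyaUrn

/-! ### The limiting path and its closed form -/

/-- The limit of `urnRatio` for urns with initial compositions asymptotic to `m • a`. -/
noncomputable def limitRatio {l : ℕ} (c : ℝ) (a : Fin l → ℝ) (s : Finset (Fin l)) : ℝ :=
  (c ^ (-∑ j ∈ s, a j) - 1) / (c ^ (-∑ j, a j) - 1)

/-- The limiting rescaled number of balls with colours in the lower set `s` at time `t`. -/
noncomputable def limitSum {l : ℕ} (c : ℝ) (k : ℕ) (a : Fin l → ℝ) (s : Finset (Fin l))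
    (t : ℝ≥0) : ℝ :=
  Real.log (1 + limitRatio c a s * (c ^ (-(∑ j, a j + k * t)) - 1)) / (-Real.log c)

theorem inv_rpow_one_div_pow {c : ℝ} (hc0 : 0 < c) (m : ℝ) (n : ℕ) :
    (c ^ (1 / m))⁻¹ ^ n = c ^ (-((n : ℝ) / m)) := by
  rw [← Real.rpow_neg hc0.le, ← Real.rpow_natCast, ← Real.rpow_mul hc0.le]
  congr 1
  ring

theorem sum_pos_of_exists_ne_zero {l : ℕ} {a : Fin l → ℝ} (ha : ∀ i, 0 ≤ a i)
    (ha' : ∃ i, a i ≠ 0) : 0 < ∑ j, a j := by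
  obtain ⟨i, hi⟩ := ha'
  exact Finset.sum_pos' (fun i _ => ha i) ⟨i, Finset.mem_univ i, lt_of_le_of_ne (ha i) hi.symm⟩

theorem one_lt_rpow_neg {c x : ℝ} (hc0 : 0 < c) (hc1 : c < 1) (hx : 0 < x) : 1 < c ^ (-x) :=
  Real.one_lt_rpow_of_pos_of_lt_one_of_neg hc0 hc1 (by linarith)

theorem one_le_rpow_neg {c x : ℝ} (hc0 : 0 < c) (hc1 : c < 1) (hx : 0 ≤ x) : 1 ≤ c ^ (-x) :=
  Real.one_le_rpow_of_pos_of_le_one_of_nonpos hc0 hc1.le (by linarith)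

/-- Recovers the ball count from the ratio and the total; `limitSum` has the same form. -/
theorem sum_div_eq_log {l : ℕ} {c : ℝ} (hc0 : 0 < c) (hc1 : c < 1) {m : ℝ} (hm : 0 < m)
    (s : Finset (Fin l)) (w : Fin l → ℕ) (hw : ∑ j, w j ≠ 0) :
    ((∑ j ∈ s, w j : ℕ) : ℝ) / m =
      Real.log (1 + urnRatio (c ^ (1 / m)) s w * (c ^ (-(((∑ j, w j : ℕ) : ℝ) / m)) - 1)) /
        (-Real.log c) := by
  have hpos : (0 : ℝ) < (∑ j, w j : ℕ) := by exact_mod_cast Nat.pos_of_ne_zero hw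
  have h1 : 1 < c ^ (-(((∑ j, w j : ℕ) : ℝ) / m)) := one_lt_rpow_neg hc0 hc1 (by positivity)
  have hlog : Real.log c ≠ 0 := (Real.log_neg hc0 hc1).ne
  rw [urnRatio, inv_rpow_one_div_pow hc0, inv_rpow_one_div_pow hc0,
    div_mul_cancel₀ _ (by linarith), add_sub_cancel, Real.log_rpow hc0]
  field_simp

theorem limitRatio_nonneg {l : ℕ} {c : ℝ} (hc0 : 0 < c) (hc1 : c < 1) {a : Fin l → ℝ}
    (ha : ∀ i, 0 ≤ a i) (s : Finset (Fin l)) : 0 ≤ limitRatio c a s := by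
  have h (s : Finset (Fin l)) : 0 ≤ c ^ (-∑ j ∈ s, a j) - 1 :=
    sub_nonneg.mpr (one_le_rpow_neg hc0 hc1 (Finset.sum_nonneg fun i _ => ha i))
  exact div_nonneg (h s) (h _)

theorem one_add_limitRatio_mul_pos {l : ℕ} {c : ℝ} (hc0 : 0 < c) (hc1 : c < 1) {a : Fin l → ℝ}
    (ha : ∀ i, 0 ≤ a i) (s : Finset (Fin l)) (k : ℕ) (t : ℝ≥0) :
    0 < 1 + limitRatio c a s * (c ^ (-(∑ j, a j + k * t)) - 1) := by
  have h0 := limitRatio_nonneg hc0 hc1 ha s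
  have h1 : 1 ≤ c ^ (-(∑ j, a j + k * t)) :=
    one_le_rpow_neg hc0 hc1 (add_nonneg (Finset.sum_nonneg fun i _ => ha i) (by positivity))
  nlinarith

theorem continuous_limitSum {l : ℕ} {c : ℝ} (hc0 : 0 < c) (hc1 : c < 1) {a : Fin l → ℝ}
    (ha : ∀ i, 0 ≤ a i) (k : ℕ) (s : Finset (Fin l)) : Continuous (limitSum c k a s) := by
  have hpow : Continuous fun t : ℝ≥0 => c ^ (-(∑ j, a j + k * (t : ℝ))) :=
    Continuous.rpow continuous_const (by fun_prop) fun _ => Or.inl hc0.ne'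
  refine Continuous.div_const (Continuous.log ?_ fun t => ?_) _
  · fun_prop
  · exact (one_add_limitRatio_mul_pos hc0 hc1 ha s k t).ne'

theorem limitSum_Iic_sub_limitSum_Iio {l : ℕ} {c : ℝ} (hc0 : 0 < c) (hc1 : c < 1)
    {a : Fin l → ℝ} (ha : ∀ i, 0 ≤ a i) (ha' : ∃ i, a i ≠ 0) (k : ℕ) (t : ℝ≥0) (i : Fin l) :
    limitSum c k a (Finset.Iic i) t - limitSum c k a (Finset.Iio i) t =
      a i + 1 / Real.log c * Real.log
        (((1 - c ^ ((∑ j, a j) + (k : ℝ) * (t : ℝ)))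
            - c ^ (∑ j ∈ Finset.Iio i, a j) * (1 - c ^ ((k : ℝ) * (t : ℝ)))) /
          ((1 - c ^ ((∑ j, a j) + (k : ℝ) * (t : ℝ)))
            - c ^ (∑ j ∈ Finset.Iic i, a j) * (1 - c ^ ((k : ℝ) * (t : ℝ))))) := by
  have hσ := sum_pos_of_exists_ne_zero ha ha'
  have hlog : Real.log c ≠ 0 := (Real.log_neg hc0 hc1).ne
  set C : ℝ := c ^ (-(∑ j, a j + k * (t : ℝ))) / (c ^ (-∑ j, a j) - 1)
  have hC : 0 < C :=
    div_pos (by positivity) (by linarith [one_lt_rpow_neg hc0 hc1 hσ])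
  set D : Finset (Fin l) → ℝ := fun s => (1 - c ^ ((∑ j, a j) + (k : ℝ) * (t : ℝ)))
    - c ^ (∑ j ∈ s, a j) * (1 - c ^ ((k : ℝ) * (t : ℝ))) with hD
  -- The factor `C` does not depend on `s`, so it cancels in the difference of logarithms, and `c ^
  -- (-∑ j ∈ s, a j)` contributes the summand `a i`.
  have key (s : Finset (Fin l)) : 1 + limitRatio c a s * (c ^ (-(∑ j, a j + k * (t : ℝ))) - 1) =
      c ^ (-∑ j ∈ s, a j) * (C * D s) := by
    have h1 : c ^ (-∑ j, a j) - 1 ≠ 0 := by linarith [one_lt_rpow_neg hc0 hc1 hσ]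
    have h2 : c ^ (∑ j ∈ s, a j) ≠ 0 := by positivity
    have h3 : c ^ (∑ j, a j) ≠ 0 := by positivity
    have h4 : c ^ ((k : ℝ) * (t : ℝ)) ≠ 0 := by positivity
    simp only [limitRatio, C, D]
    rw [Real.rpow_neg hc0.le, Real.rpow_neg hc0.le, Real.rpow_neg hc0.le] at *
    rw [Real.rpow_add hc0] at *
    generalize c ^ (∑ j ∈ s, a j) = x at *
    generalize c ^ (∑ j, a j) = y at *
    generalize c ^ ((k : ℝ) * (t : ℝ)) = z at *
    have h5 : 1 - y ≠ 0 := by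
      intro h
      apply h1
      rw [show y = 1 by linarith]
      simp
    have h6 : y⁻¹ - 1 = (1 - y) / y := by field_simp
    rw [h6]
    field_simp
    ring
  have hDpos (s : Finset (Fin l)) : 0 < D s := by
    have h := one_add_limitRatio_mul_pos hc0 hc1 ha s k t
    rw [key s, ← mul_assoc] at h
    exact pos_of_mul_pos_right h (by positivity)
  have hlim (s : Finset (Fin l)) : limitSum c k a s t =
      (-(∑ j ∈ s, a j) * Real.log c + (Real.log C + Real.log (D s))) / (-Real.log c) := by
    rw [limitSum, key s, Real.log_mul (by positivity) (mul_pos hC (hDpos s)).ne',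
      Real.log_mul hC.ne' (hDpos s).ne', Real.log_rpow hc0]
  have hsum : ∑ j ∈ Finset.Iic i, a j = ∑ j ∈ Finset.Iio i, a j + a i := by
    rw [← Finset.Iio_insert, Finset.sum_insert (by simp), add_comm]
  change _ = a i + 1 / Real.log c * Real.log (D (Finset.Iio i) / D (Finset.Iic i))
  rw [hlim, hlim, Real.log_div (hDpos _).ne' (hDpos _).ne', hsum]
  field_simp
  ring

/-- The limiting path. -/
noncomputable def limitPath {l : ℕ} {c : ℝ} (hc0 : 0 < c) (hc1 : c < 1) (k : ℕ)
    {a : Fin l → ℝ} (ha : ∀ i, 0 ≤ a i) : SkorokhodSpace (Fin l → ℝ) where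
  toFun t i := limitSum c k a (Finset.Iic i) t - limitSum c k a (Finset.Iio i) t
  isCadlag t := by
    have h : Continuous fun (t : ℝ≥0) (i : Fin l) =>
        limitSum c k a (Finset.Iic i) t - limitSum c k a (Finset.Iio i) t :=
      continuous_pi fun i =>
        (continuous_limitSum hc0 hc1 ha k _).sub (continuous_limitSum hc0 hc1 ha k _)
    exact ⟨h.continuousWithinAt, _, (h.tendsto t).mono_left nhdsWithin_le_nhds⟩

/-! ### Asymptotics as `m → ∞` -/

theorem tendsto_natFloor_mul_div_pnat (t : ℝ≥0) :
    Tendsto (fun m : ℕ+ => (⌊(m : ℝ) * (t : ℝ)⌋₊ : ℝ) / (m : ℝ)) atTop (𝓝 (t : ℝ)) := by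
  have h := (tendsto_nat_floor_mul_div_atTop (R := ℝ) t.coe_nonneg).comp
    (tendsto_natCast_atTop_atTop.comp tendsto_PNat_val_atTop_atTop)
  refine h.congr fun m => ?_
  simp [mul_comm]

theorem tendsto_pnat_inv : Tendsto (fun m : ℕ+ => (m : ℝ)⁻¹) atTop (𝓝 0) :=
  tendsto_inv_atTop_zero.comp (tendsto_natCast_atTop_atTop.comp tendsto_PNat_val_atTop_atTop)

section Limits

variable {l : ℕ} {c : ℝ} {w₀ : ℕ+ → Fin l → ℕ} {a : Fin l → ℝ}

theorem tendsto_sum_div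
    (hlim : ∀ i, Tendsto (fun m : ℕ+ => (w₀ m i : ℝ) / (m : ℝ)) atTop (𝓝 (a i)))
    (s : Finset (Fin l)) :
    Tendsto (fun m : ℕ+ => ((∑ j ∈ s, w₀ m j : ℕ) : ℝ) / (m : ℝ)) atTop
      (𝓝 (∑ j ∈ s, a j)) := by
  simp only [Nat.cast_sum, Finset.sum_div]
  exact tendsto_finsetSum _ fun i _ => hlim i

theorem tendsto_rpow_neg_sum_div (hc0 : 0 < c)
    (hlim : ∀ i, Tendsto (fun m : ℕ+ => (w₀ m i : ℝ) / (m : ℝ)) atTop (𝓝 (a i)))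
    (s : Finset (Fin l)) :
    Tendsto (fun m : ℕ+ => c ^ (-(((∑ j ∈ s, w₀ m j : ℕ) : ℝ) / (m : ℝ)))) atTop
      (𝓝 (c ^ (-∑ j ∈ s, a j))) :=
  tendsto_const_nhds.rpow (tendsto_sum_div hlim s).neg (Or.inl hc0.ne')

theorem tendsto_urnRatio_init (hc0 : 0 < c) (hc1 : c < 1) (ha : ∀ i, 0 ≤ a i)
    (ha' : ∃ i, a i ≠ 0)
    (hlim : ∀ i, Tendsto (fun m : ℕ+ => (w₀ m i : ℝ) / (m : ℝ)) atTop (𝓝 (a i)))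
    (s : Finset (Fin l)) :
    Tendsto (fun m : ℕ+ => urnRatio (c ^ (1 / (m : ℝ))) s (w₀ m)) atTop
      (𝓝 (limitRatio c a s)) := by
  simp only [urnRatio, inv_rpow_one_div_pow hc0]
  refine ((tendsto_rpow_neg_sum_div hc0 hlim s).sub_const 1).div
    ((tendsto_rpow_neg_sum_div hc0 hlim _).sub_const 1) ?_
  linarith [one_lt_rpow_neg hc0 hc1 (sum_pos_of_exists_ne_zero ha ha')]

/-- The bracket is `exp x - 1 ≤ x * exp x` with `x = k * (-log c) / m`, so the whole is `O(1 / m)`.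
-/
theorem tendsto_mul_sq_rpow_sub_one (hc0 : 0 < c) (hc1 : c < 1) (k : ℕ) :
    Tendsto (fun m : ℕ+ => (m : ℝ) * (c ^ (-((k : ℝ) / (m : ℝ))) - 1) ^ 2) atTop (𝓝 0) := by
  have hlog : Real.log c < 0 := Real.log_neg hc0 hc1
  have hup : Tendsto (fun m : ℕ+ => (k * -Real.log c * c ^ (-(k : ℝ))) ^ 2 * (m : ℝ)⁻¹) atTop
      (𝓝 0) := by
    have h := tendsto_pnat_inv.const_mul ((k * -Real.log c * c ^ (-(k : ℝ))) ^ 2)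
    rwa [mul_zero] at h
  refine squeeze_zero (fun m => by positivity) (fun m => ?_) hup
  have hm : (1 : ℝ) ≤ m := by exact_mod_cast one_le (a := m)
  set x : ℝ := (k : ℝ) / m * -Real.log c
  have hx : 0 ≤ x := mul_nonneg (by positivity) (by linarith)
  have hexp : c ^ (-((k : ℝ) / (m : ℝ))) = Real.exp x := by
    rw [Real.rpow_def_of_pos hc0]
    congr 1
    ring
  have h1 : Real.exp x - 1 ≤ x * Real.exp x := by
    have h := Real.add_one_le_exp (-x)
    have h2 : Real.exp x * Real.exp (-x) = 1 := by rw [← Real.exp_add]; simp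
    nlinarith [Real.exp_pos x]
  have h2 : Real.exp x ≤ c ^ (-(k : ℝ)) := by
    rw [← hexp]
    refine Real.rpow_le_rpow_of_exponent_ge hc0 hc1.le (neg_le_neg ?_)
    exact div_le_self (by positivity) hm
  have h3 : Real.exp x - 1 ≤ x * c ^ (-(k : ℝ)) :=
    h1.trans (mul_le_mul_of_nonneg_left h2 hx)
  have h0 : 0 ≤ Real.exp x - 1 := by linarith [Real.one_le_exp hx]
  rw [hexp]
  calc (m : ℝ) * (Real.exp x - 1) ^ 2 ≤ m * (x * c ^ (-(k : ℝ))) ^ 2 := by gcongr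
    _ = (k * -Real.log c * c ^ (-(k : ℝ))) ^ 2 * (m : ℝ)⁻¹ := by
      simp only [x]
      field_simp

theorem tendsto_floor_mul_sq_urnRatioStep (hc0 : 0 < c) (hc1 : c < 1) (ha : ∀ i, 0 ≤ a i)
    (ha' : ∃ i, a i ≠ 0)
    (hlim : ∀ i, Tendsto (fun m : ℕ+ => (w₀ m i : ℝ) / (m : ℝ)) atTop (𝓝 (a i)))
    (k : ℕ) (t : ℝ≥0) :
    Tendsto (fun m : ℕ+ => (⌊(m : ℝ) * (t : ℝ)⌋₊ : ℝ) *
      urnRatioStep (c ^ (1 / (m : ℝ))) k (∑ j, w₀ m j) ^ 2) atTop (𝓝 0) := by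
  have h1 := tendsto_rpow_neg_sum_div hc0 hlim Finset.univ
  have h2 := h1.div (h1.sub_const 1)
    (by linarith [one_lt_rpow_neg hc0 hc1 (sum_pos_of_exists_ne_zero ha ha')])
  -- The quantity factors as `⌊m t⌋ / m`, times `m` times a squared difference tending to `0`, times
  -- a factor whose limit is finite because `∑ j, a j > 0`.
  have h3 := ((tendsto_natFloor_mul_div_pnat t).mul
    (tendsto_mul_sq_rpow_sub_one hc0 hc1 k)).mul (h2.pow 2)
  rw [mul_zero, zero_mul] at h3
  refine h3.congr fun m => ?_
  have hm : (m : ℝ) ≠ 0 := by exact_mod_cast m.ne_zero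
  simp only [urnRatioStep, inv_rpow_one_div_pow hc0, Pi.div_apply]
  field_simp

end Limits

/-! ### From fixed times to uniform convergence -/

/-- Convergence of monotone functions to a continuous function at finitely many points controls
the uniform distance on a bounded interval. -/
theorem exists_finset_forall_monotone_abs_sub_lt {x : ℝ≥0 → ℝ} (hx : Continuous x) (T : ℝ≥0)
    {ε : ℝ} (hε : 0 < ε) :
    ∃ G : Finset ℝ≥0, ∀ y : ℝ≥0 → ℝ, Monotone y → (∀ t ∈ G, |y t - x t| < ε / 2) →
      ∀ t ≤ T, |y t - x t| < ε := by
  have huc := (isCompact_Icc (a := (0 : ℝ≥0)) (b := T + 1)).uniformContinuousOn_of_continuous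
    hx.continuousOn
  obtain ⟨δ, hδ, hxδ⟩ := Metric.uniformContinuousOn_iff.mp huc (ε / 2) (by linarith)
  -- Grid mesh: below `δ` for uniform continuity, and below `1` so that the grid point just past `T`
  -- stays in `[0, T + 1]`.
  obtain ⟨h, hh0, hh1⟩ : ∃ h : ℝ≥0, 0 < h ∧ (h : ℝ) < min δ 1 := by
    obtain ⟨r, hr0, hr1⟩ := exists_between (lt_min hδ one_pos)
    exact ⟨⟨r, hr0.le⟩, hr0, hr1⟩
  have hhδ : (h : ℝ) < δ := hh1.trans_le (min_le_left _ _)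
  have hh1 : h ≤ 1 := by exact_mod_cast (hh1.trans_le (min_le_right _ _)).le
  refine ⟨(Finset.range (⌊T / h⌋₊ + 2)).image fun j : ℕ => (j : ℝ≥0) * h, fun y hy hG t ht => ?_⟩
  set j := ⌊t / h⌋₊
  have hjT : j ≤ ⌊T / h⌋₊ := Nat.floor_le_floor (by gcongr)
  have hlow : (j : ℝ≥0) * h ≤ t := (le_div_iff₀ hh0).mp (Nat.floor_le (by positivity))
  have hupp : t ≤ ((j + 1 : ℕ) : ℝ≥0) * h := by
    rw [← div_le_iff₀ hh0]
    exact_mod_cast (Nat.lt_floor_add_one (t / h)).le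
  have hstep : ((j + 1 : ℕ) : ℝ≥0) * h = j * h + h := by push_cast; ring
  have g1 := hG (j * h) (Finset.mem_image_of_mem _ (Finset.mem_range.mpr (by omega)))
  have g2 := hG (((j + 1 : ℕ) : ℝ≥0) * h)
    (Finset.mem_image_of_mem _ (Finset.mem_range.mpr (by omega)))
  have hlow' : ((j * h : ℝ≥0) : ℝ) ≤ t := hlow
  have hupp' : (t : ℝ) ≤ (((j + 1 : ℕ) : ℝ≥0) * h : ℝ≥0) := hupp
  have hstep' : ((((j + 1 : ℕ) : ℝ≥0) * h : ℝ≥0) : ℝ) = ((j * h : ℝ≥0) : ℝ) + h := by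
    rw [hstep, NNReal.coe_add]
  have hmem : t ∈ Set.Icc 0 (T + 1) := ⟨zero_le, ht.trans (le_add_of_nonneg_right zero_le_one)⟩
  have d1 := hxδ (j * h) ⟨zero_le, hlow.trans hmem.2⟩ t hmem (by
    rw [NNReal.dist_eq, abs_lt]; constructor <;> linarith)
  have d2 := hxδ (((j + 1 : ℕ) : ℝ≥0) * h)
    ⟨zero_le, hstep.le.trans (add_le_add (hlow.trans ht) hh1)⟩ t hmem (by
    rw [NNReal.dist_eq, abs_lt]; constructor <;> linarith)
  have m1 := hy hlow
  have m2 := hy hupp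
  rw [Real.dist_eq] at d1 d2
  rw [abs_lt] at *
  constructor <;> linarith [g1.1, g1.2, g2.1, g2.2, d1.1, d1.2, d2.1, d2.2]

/-- A union bound; subadditivity of outer measure suffices, so the events need not be measurable. -/
theorem tendsto_measure_zero_of_ae_imp {ι : Type*} {L : Filter ι} {Ω : ι → Type*}
    [∀ i, MeasurableSpace (Ω i)] {μ : ∀ i, Measure (Ω i)} {β : Type*} (G : Finset β)
    {P : ∀ i, Ω i → Prop} {Q : β → ∀ i, Ω i → Prop}
    (hPQ : ∀ i, ∀ᵐ ω ∂μ i, (∀ b ∈ G, Q b i ω) → P i ω)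
    (hQ : ∀ b ∈ G, Tendsto (fun i => μ i {ω | ¬ Q b i ω}) L (𝓝 0)) :
    Tendsto (fun i => μ i {ω | ¬ P i ω}) L (𝓝 0) := by
  have h := tendsto_finsetSum G hQ
  rw [Finset.sum_const_zero] at h
  refine tendsto_of_tendsto_of_tendsto_of_le_of_le tendsto_const_nhds h (fun _ => zero_le)
    fun i => le_trans ?_ (measure_biUnion_finset_le G fun b => {ω | ¬ Q b i ω})
  refine measure_mono_ae ?_
  filter_upwards [hPQ i] with ω hω hP
  by_contra hcon
  refine hP (hω fun b hb => ?_)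
  by_contra hb'
  exact hcon (Set.mem_biUnion hb hb')

theorem IsQPolyaUrn.ae_monotone_sum {l : ℕ} {Ω : Type*} [MeasurableSpace Ω] {μ : Measure Ω}
    [IsProbabilityMeasure μ] {q : ℝ} {k : ℕ} {w₀ : Fin l → ℕ} {A : ℕ → Ω → Fin l → ℕ}
    (hA : IsQPolyaUrn μ q k w₀ A) (hk : 0 < k) (hq0 : 0 < q) (hq1 : q < 1)
    (s : Finset (Fin l)) : ∀ᵐ ω ∂μ, Monotone fun n => ∑ j ∈ s, A n ω j := by
  filter_upwards [hA.ae_step hk hq0 hq1] with ω hω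
  refine monotone_nat_of_le_succ fun n => ?_
  obtain ⟨i, hi⟩ := hω n
  simp only [hi, sum_add_single]
  omega

section Convergence

variable {l k : ℕ} {c : ℝ} {Ω : ℕ+ → Type*} [∀ m, MeasurableSpace (Ω m)]
  {μ : ∀ m, Measure (Ω m)} [∀ m, IsProbabilityMeasure (μ m)]
  {w₀ : ℕ+ → Fin l → ℕ} {A : ∀ m, ℕ → Ω m → Fin l → ℕ} {a : Fin l → ℝ}

theorem tendsto_measure_sum_at (hk : 0 < k) (hc0 : 0 < c) (hc1 : c < 1)
    (hA : ∀ m : ℕ+, IsQPolyaUrn (μ m) (c ^ (1 / (m : ℝ))) k (w₀ m) (A m))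
    (ha : ∀ i, 0 ≤ a i) (ha' : ∃ i, a i ≠ 0)
    (hlim : ∀ i, Tendsto (fun m : ℕ+ => (w₀ m i : ℝ) / (m : ℝ)) atTop (𝓝 (a i)))
    {s : Finset (Fin l)} (hs : IsLowerSet (s : Set (Fin l))) (t : ℝ≥0) {ε : ℝ} (hε : 0 < ε) :
    Tendsto (fun m : ℕ+ => μ m {ω | ¬
      |((∑ j ∈ s, A m ⌊(m : ℝ) * (t : ℝ)⌋₊ ω j : ℕ) : ℝ) / (m : ℝ) - limitSum c k a s t| < ε})
      atTop (𝓝 0) := by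
  have hq0 (m : ℕ+) : 0 < c ^ (1 / (m : ℝ)) := by positivity
  have hq1 (m : ℕ+) : c ^ (1 / (m : ℝ)) < 1 :=
    Real.rpow_lt_one hc0.le hc1 (one_div_pos.mpr (by exact_mod_cast m.pos))
  set v : ℕ+ → ℝ := fun m =>
    c ^ (-(((∑ j, w₀ m j + k * ⌊(m : ℝ) * (t : ℝ)⌋₊ : ℕ) : ℝ) / (m : ℝ))) - 1
  set v₀ : ℝ := c ^ (-(∑ j, a j + k * (t : ℝ))) - 1
  have hv : Tendsto v atTop (𝓝 v₀) := by
    refine (tendsto_const_nhds.rpow (Tendsto.neg ?_) (Or.inl hc0.ne')).sub_const 1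
    refine ((tendsto_sum_div hlim Finset.univ).add
      ((tendsto_natFloor_mul_div_pnat t).const_mul (k : ℝ))).congr fun m => ?_
    push_cast
    ring
  -- The count is this function of the random ratio and the deterministic total. The first
  -- coordinate's tolerance `δ` is split between fluctuation from the initial ratio and convergence
  -- of that ratio.
  have hF : ContinuousAt (fun p : ℝ × ℝ => Real.log (1 + p.1 * p.2) / (-Real.log c))
      (limitRatio c a s, v₀) := by
    refine (ContinuousAt.log (by fun_prop) ?_).div_const _
    exact (one_add_limitRatio_mul_pos hc0 hc1 ha s k t).ne'
  obtain ⟨δ, hδ, hFδ⟩ := Metric.continuousAt_iff.mp hF ε hε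
  have hbound : Tendsto (fun m : ℕ+ => ENNReal.ofReal ((⌊(m : ℝ) * (t : ℝ)⌋₊ : ℝ) *
      urnRatioStep (c ^ (1 / (m : ℝ))) k (∑ j, w₀ m j) ^ 2 / (δ / 2) ^ 2)) atTop (𝓝 0) := by
    simpa using ENNReal.tendsto_ofReal
      ((tendsto_floor_mul_sq_urnRatioStep hc0 hc1 ha ha' hlim k t).div_const ((δ / 2) ^ 2))
  refine tendsto_of_tendsto_of_tendsto_of_le_of_le' tendsto_const_nhds hbound
    (Eventually.of_forall fun _ => zero_le) ?_
  filter_upwards [Metric.tendsto_nhds.mp hv δ hδ, Metric.tendsto_nhds.mp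
    (tendsto_urnRatio_init hc0 hc1 ha ha' hlim s) (δ / 2) (by linarith)] with m hvm hrm
  refine le_trans (measure_mono_ae ?_)
    ((hA m).measure_le_abs_urnRatio_sub hk (hq0 m) (hq1 m) hs _ (half_pos hδ))
  filter_upwards [(hA m).ae_sum_eq hk (hq0 m) (hq1 m) ⌊(m : ℝ) * (t : ℝ)⌋₊] with ω hω hbad
  by_contra hcon
  refine hbad ?_
  have hcon' := not_le.mp hcon
  have hne : ∑ j, A m ⌊(m : ℝ) * (t : ℝ)⌋₊ ω j ≠ 0 := by
    have := (hA m).sum_init_ne_zero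
    omega
  rw [sum_div_eq_log hc0 hc1 (by exact_mod_cast m.pos) s _ hne, hω, ← Real.dist_eq]
  refine hFδ (x := (urnRatio (c ^ (1 / (m : ℝ))) s (A m ⌊(m : ℝ) * (t : ℝ)⌋₊ ω), v m)) ?_
  rw [Prod.dist_eq, max_lt_iff]
  refine ⟨?_, hvm⟩
  rw [← Real.dist_eq] at hcon'
  exact (dist_triangle _ _ _).trans_lt (by linarith)

theorem tendsto_measure_sum_uniform (hk : 0 < k) (hc0 : 0 < c) (hc1 : c < 1)
    (hA : ∀ m : ℕ+, IsQPolyaUrn (μ m) (c ^ (1 / (m : ℝ))) k (w₀ m) (A m))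
    (ha : ∀ i, 0 ≤ a i) (ha' : ∃ i, a i ≠ 0)
    (hlim : ∀ i, Tendsto (fun m : ℕ+ => (w₀ m i : ℝ) / (m : ℝ)) atTop (𝓝 (a i)))
    {s : Finset (Fin l)} (hs : IsLowerSet (s : Set (Fin l))) (T : ℝ≥0) {ε : ℝ} (hε : 0 < ε) :
    Tendsto (fun m : ℕ+ => μ m {ω | ¬ ∀ t ≤ T,
      |((∑ j ∈ s, A m ⌊(m : ℝ) * (t : ℝ)⌋₊ ω j : ℕ) : ℝ) / (m : ℝ) - limitSum c k a s t| < ε})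
      atTop (𝓝 0) := by
  have hq1 (m : ℕ+) : c ^ (1 / (m : ℝ)) < 1 :=
    Real.rpow_lt_one hc0.le hc1 (one_div_pos.mpr (by exact_mod_cast m.pos))
  obtain ⟨G, hG⟩ :=
    exists_finset_forall_monotone_abs_sub_lt (continuous_limitSum hc0 hc1 ha k s) T hε
  refine tendsto_measure_zero_of_ae_imp G (fun m => ?_) fun t _ =>
    tendsto_measure_sum_at hk hc0 hc1 hA ha ha' hlim hs t (half_pos hε)
  filter_upwards [(hA m).ae_monotone_sum hk (by positivity) (hq1 m) s] with ω hω h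
  refine hG (fun t => ((∑ j ∈ s, A m ⌊(m : ℝ) * (t : ℝ)⌋₊ ω j : ℕ) : ℝ) / (m : ℝ)) ?_ h
  intro t t' htt'
  have hfl : ⌊(m : ℝ) * (t : ℝ)⌋₊ ≤ ⌊(m : ℝ) * (t' : ℝ)⌋₊ := Nat.floor_le_floor (by gcongr)
  exact div_le_div_of_nonneg_right (by exact_mod_cast hω hfl) (by positivity)

end Convergence

theorem theorem1p12 {l : ℕ} (hl : 2 ≤ l) {k : ℕ} (hk : 0 < k) {c : ℝ} (hc0 : 0 < c) (hc1 : c < 1)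
    {Ω : ℕ+ → Type*} [∀ m, MeasurableSpace (Ω m)]
    (μ : ∀ m, Measure (Ω m)) [∀ m, IsProbabilityMeasure (μ m)]
    (w₀ : ℕ+ → Fin l → ℕ) (A : ∀ m, ℕ → Ω m → Fin l → ℕ)
    (hA : ∀ m : ℕ+, IsQPolyaUrn (μ m) (c ^ (1 / (m : ℝ))) k (w₀ m) (A m))
    (a : Fin l → ℝ) (ha : ∀ i, 0 ≤ a i) (ha' : ∃ i, a i ≠ 0)
    (hlim : ∀ i, Tendsto (fun m : ℕ+ => (w₀ m i : ℝ) / (m : ℝ)) atTop (𝓝 (a i))) :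
    ∃ X : SkorokhodSpace (Fin l → ℝ),
      (∀ (t : ℝ≥0) (i : Fin l),
        X t i = a i + 1 / Real.log c * Real.log
          (((1 - c ^ ((∑ j, a j) + (k : ℝ) * (t : ℝ)))
              - c ^ (∑ j ∈ Finset.Iio i, a j) * (1 - c ^ ((k : ℝ) * (t : ℝ)))) /
            ((1 - c ^ ((∑ j, a j) + (k : ℝ) * (t : ℝ)))
              - c ^ (∑ j ∈ Finset.Iic i, a j) * (1 - c ^ ((k : ℝ) * (t : ℝ)))))) ∧
      TendstoInDistribution
        (fun (m : ℕ+) (ω : Ω m) => rescaledPath m (fun n => A m n ω))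
        atTop (fun _ : Unit => X) μ (Measure.dirac ()) := by
  refine ⟨limitPath hc0 hc1 k ha,
    fun t i => limitSum_Iic_sub_limitSum_Iio hc0 hc1 ha ha' k t i, ?_⟩
  refine SkorokhodSpace.tendstoInDistribution_dirac_of_basicNhd μ _
    (fun m => measurable_rescaledPath_comp m (hA m).measurable) _ fun T ε hε => ?_
  refine tendsto_measure_zero_of_ae_imp
    (Q := fun s m ω => ∀ t ≤ T, |((∑ j ∈ s, A m ⌊(m : ℝ) * (t : ℝ)⌋₊ ω j : ℕ) : ℝ) / (m : ℝ)
      - limitSum c k a s t| < ε / 2)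
    -- Colour `i` is the difference of the segments `Iic i` and `Iio i`, each controlled to within
    -- `ε / 2`.
    (Finset.univ.image Finset.Iic ∪ Finset.univ.image Finset.Iio)
    (fun m => Eventually.of_forall fun ω h => ?_) fun s hs =>
    tendsto_measure_sum_uniform hk hc0 hc1 hA ha ha' hlim ?_ T (half_pos hε)
  · refine ⟨OrderIso.refl _, fun t ht => ⟨by simpa using hε, ?_⟩⟩
    rw [dist_pi_lt_iff hε]
    intro i
    have h1 := h (Finset.Iic i) (by simp) t ht
    have h2 := h (Finset.Iio i) (by simp) t ht
    have hsum : ∑ j ∈ Finset.Iic i, A m ⌊(m : ℝ) * (t : ℝ)⌋₊ ω j =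
        A m ⌊(m : ℝ) * (t : ℝ)⌋₊ ω i + ∑ j ∈ Finset.Iio i, A m ⌊(m : ℝ) * (t : ℝ)⌋₊ ω j := by
      rw [← Finset.Iio_insert, Finset.sum_insert (by simp)]
    rw [hsum, Nat.cast_add, add_div] at h1
    change dist ((A m ⌊(m : ℝ) * (t : ℝ)⌋₊ ω i : ℝ) / (m : ℝ))
      (limitSum c k a (Finset.Iic i) t - limitSum c k a (Finset.Iio i) t) < ε
    rw [Real.dist_eq]
    rw [abs_lt] at *
    constructor <;> linarith [h1.1, h1.2, h2.1, h2.2]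
  · rcases Finset.mem_union.mp hs with hs | hs
    · obtain ⟨i, -, rfl⟩ := Finset.mem_image.mp hs
      simpa using isLowerSet_Iic i
    · obtain ⟨i, -, rfl⟩ := Finset.mem_image.mp hs
      simpa using isLowerSet_Iio i
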